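/- Let $H$ be a separable (real or complex) Hilbert space and let $A\colon D(A)\subset H\to H$ be a densely defined self-adjoint operator with compact resolvent (for some real $\lambda>-\kappa$ in the resolvent set, $(\lambda-A)^{-1}$ is compact) that is bounded above: $\langle Au,u\rangle\le\kappa\|u\|^2$ for all $u\in D(A)$, where $\kappa\ge 0$. For an eigenvalue $\lambda$ of $-A$ let $P_\lambda$ be the orthogonal projection onto its eigenspace. For $\epsilon>0$ let $(\kappa-A)^\epsilon u=\sum_{\lambda}(\kappa+\lambda)^\epsilon P_\lambda u$, the sum being over the eigenvalues $\lambda$ of $-A$, with domain $D((\kappa-A)^\epsilon)=\{u\in H:\sum_\lambda(\kappa+\lambda)^{2\epsilon}\|P_\lambda u\|^2<\infty\}$ and graph norm $\|u\|_{D((\kappa-A)^\epsilon)}=\left(\|u\|^2+\|(\kappa-A)^\epsilon u\|^2\right)^{1/2}$. Let $\lambda_{m+1}$ denote the smallest positive eigenvalue of $-A$ (it exists if $\dim H=\infty$; read it as $0$ if there is none). Let $0<\alpha<1$, $T>0$, $\epsilon>0$, $R>0$ and $\beta=\frac{\epsilon}{\epsilon+1}$. Then there is a constant $C_2>0$, depending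 only on $\alpha$, $T$ and $\lambda_{m+1}$ (and not on $\epsilon$, $R$, $u_0$, or otherwise on $H$, $A$, $\kappa$), such that the following holds. Let $u_0\in D((\kappa-A)^\epsilon)$ with $\|u_0\|_{D((\kappa-A)^\epsilon)}\le R$, and let $u$ be a solution of $$\partial_t^\alpha u(t)=Au(t),\quad 0<t<T,\qquad u(0)=u_0,$$ where $\partial_t^\alpha u(t)=\frac{1}{\Gamma(1-\alpha)}\int_0^t(t-s)^{-\alpha}u'(s)\,ds$ is the Caputo derivative; that is, $u\in C([0,T];H)$ is absolutely continuous on $[0,t]$ (the integral of its integrable derivative) for every $t<T$, and for every $t\in(0,T)$ the integral defining $\partial_t^\alpha u(t)$ converges absolutely, $u(t)\in D(A)$, and the equation holds. Then $$\|u(0)\|\le\left(1+C_2^{\beta}R^{1-\beta}\right)\|u(T)\|^{\beta}.$$ -/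

import Mathlib

namespace CaputoBackward

section Operator

variable {𝕜 H : Type*} [RCLike 𝕜] [NormedAddCommGroup H] [InnerProductSpace 𝕜 H]

/-- The bounded operator `R` is the resolvent `(l - A)⁻¹` of the unbounded operator `A` at the
real point `l`. -/
def IsResolventAt (A : H →ₗ.[𝕜] H) (l : ℝ) (R : H →L[𝕜] H) : Prop :=
  (∀ x : H, ∃ h : R x ∈ A.domain, (l : 𝕜) • R x - A ⟨R x, h⟩ = x) ∧
    ∀ x : A.domain, R ((l : 𝕜) • (x : H) - A x) = x

/-- The standing assumption on the operator `A` : it is self-adjoint (hence densely defined, see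
`IsSelfAdjoint.dense_domain`), bounded above by `κ ≥ 0`, and has compact resolvent. -/
structure StandingAssumption [CompleteSpace H] (A : H →ₗ.[𝕜] H) (κ : ℝ) : Prop where
  selfAdjoint : IsSelfAdjoint A
  kappa_nonneg : 0 ≤ κ
  boundedAbove : ∀ x : A.domain, RCLike.re (inner 𝕜 (A x) (x : H)) ≤ κ * ‖(x : H)‖ ^ 2
  compactResolvent : ∃ l : ℝ, -κ < l ∧ ∃ R : H →L[𝕜] H, IsResolventAt A l R ∧ IsCompactOperator R

/-- The eigenspace `{x ∈ D(A) : -A x = l x}` of `-A` for the real number `l`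
(it is `⊥` if `l` is not an eigenvalue of `-A`). -/
def negEigenspace (A : H →ₗ.[𝕜] H) (l : ℝ) : Submodule 𝕜 H where
  carrier := {x | ∃ h : x ∈ A.domain, -A ⟨x, h⟩ = (l : 𝕜) • x}
  zero_mem' := ⟨A.domain.zero_mem, by
    have : (⟨0, A.domain.zero_mem⟩ : A.domain) = 0 := rfl
    rw [this, LinearPMap.map_zero]; simp⟩
  add_mem' := by
    rintro x y ⟨hx, ex⟩ ⟨hy, ey⟩
    refine ⟨A.domain.add_mem hx hy, ?_⟩
    have : (⟨x + y, A.domain.add_mem hx hy⟩ : A.domain) = ⟨x, hx⟩ + ⟨y, hy⟩ := rfl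
    rw [this, LinearPMap.map_add, neg_add, ex, ey, smul_add]
  smul_mem' := by
    rintro c x ⟨hx, ex⟩
    refine ⟨A.domain.smul_mem c hx, ?_⟩
    have : (⟨c • x, A.domain.smul_mem c hx⟩ : A.domain) = c • ⟨x, hx⟩ := rfl
    rw [this, LinearPMap.map_smul, ← smul_neg, ex, smul_comm]

/-- The real number `l` is an eigenvalue of `-A`. -/
def IsNegEigenvalue (A : H →ₗ.[𝕜] H) (l : ℝ) : Prop :=
  negEigenspace A l ≠ ⊥

/-- The smallest positive eigenvalue of `-A`. Under the standing assumption the infimum is attained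
as soon as there is a positive eigenvalue, in particular whenever `H` is infinite-dimensional; the
value is `0` if there is none. -/
noncomputable def firstPosEigenvalue (A : H →ₗ.[𝕜] H) : ℝ :=
  sInf {l : ℝ | 0 < l ∧ IsNegEigenvalue A l}

variable [CompleteSpace H]

/-- The orthogonal projection onto the eigenspace of `-A` for `l`. (The eigenspace of a self-adjoint
operator is closed; the closure only makes the projection available for every `A`.) -/
noncomputable def eigenProj (A : H →ₗ.[𝕜] H) (l : ℝ) : H →L[𝕜] H :=
  (negEigenspace A l).topologicalClosure.starProjection

/-- The domain of the spectral fractional power `(κ - A)^ε`: those `x` with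
`∑ₗ (κ + l)^(2ε) ‖P_l x‖² < ∞`, where `l` runs over the eigenvalues of `-A` (all other terms are
zero) and `P_l` is the projection onto the eigenspace. -/
def fracPowDomain (A : H →ₗ.[𝕜] H) (κ ε : ℝ) : Set H :=
  {x | Summable fun l : ℝ => (κ + l) ^ (2 * ε) * ‖eigenProj A l x‖ ^ 2}

/-- The spectral fractional power `(κ - A)^ε x = ∑ₗ (κ + l)^ε P_l x`. -/
noncomputable def fracPow (A : H →ₗ.[𝕜] H) (κ ε : ℝ) (x : H) : H :=
  ∑' l : ℝ, (((κ + l) ^ ε : ℝ) : 𝕜) • eigenProj A l x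

/-- The (Hilbertian) graph norm on the domain of `(κ - A)^ε`. -/
noncomputable def fracPowNorm (A : H →ₗ.[𝕜] H) (κ ε : ℝ) (x : H) : ℝ :=
  Real.sqrt (‖x‖ ^ 2 + ‖fracPow A κ ε x‖ ^ 2)

/-- The admissible set of initial data: the closed ball of radius `R` in `D((κ - A)^ε)`. -/
def admissibleSet (A : H →ₗ.[𝕜] H) (κ ε R : ℝ) : Set H :=
  {x | x ∈ fracPowDomain A κ ε ∧ fracPowNorm A κ ε x ≤ R}

end Operator

section Equation

/-- The Caputo derivative of order `α ∈ (0, 1)`,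
`∂_t^α u (t) = Γ(1 - α)⁻¹ ∫₀ᵗ (t - s)^(-α) u'(s) ds`. -/
noncomputable def caputoDeriv {H : Type*} [NormedAddCommGroup H] [NormedSpace ℝ H]
    (α : ℝ) (u : ℝ → H) (t : ℝ) : H :=
  (Real.Gamma (1 - α))⁻¹ • ∫ s in (0 : ℝ)..t, (t - s) ^ (-α) • deriv u s

variable {𝕜 H : Type*} [RCLike 𝕜] [NormedAddCommGroup H] [InnerProductSpace 𝕜 H]
  [NormedSpace ℝ H]

/-- `u` solves `∂_t^α u (t) = A u (t)` for `0 < t < T`, with `u (0) = u₀`: the function is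
continuous on `[0, T]` with values in `H`, it is absolutely continuous on `[0, t]` for all `t < T`
(its derivative is integrable and it is the integral of its derivative), and for all `t` in
`(0, T)` the integral defining the Caputo derivative converges, `u (t)` lies in `D(A)`, and the
equation holds. -/
structure IsSolution (A : H →ₗ.[𝕜] H) (α T : ℝ) (u₀ : H) (u : ℝ → H) : Prop where
  continuousOn : ContinuousOn u (Set.Icc 0 T)
  initial : u 0 = u₀
  deriv_integrable : ∀ t ∈ Set.Ioo 0 T, IntervalIntegrable (deriv u) MeasureTheory.volume 0 t
  eq_integral_deriv : ∀ t ∈ Set.Ioo 0 T, u t = u 0 + ∫ s in (0 : ℝ)..t, deriv u s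
  caputo_integrable : ∀ t ∈ Set.Ioo 0 T,
    IntervalIntegrable (fun s => (t - s) ^ (-α) • deriv u s) MeasureTheory.volume 0 t
  equation : ∀ t ∈ Set.Ioo 0 T, ∃ h : u t ∈ A.domain, caputoDeriv α u t = A ⟨u t, h⟩

end Equation

end CaputoBackward

open MeasureTheory Filter Topology Set
open scoped InnerProductSpace

/-! The backward problem is ill-posed mode by mode, but only polynomially: a mode with eigenvalue
`l` of `-A` decays under the fractional flow by at most a factor of order `1 + l⁺`, where `l⁺ = max
l 0`. This is proved without Mittag-Leffler functions. If `f` solves `∂_t^α f = -l f` with `f 0 > 0`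
and `t` is a running minimum, integration by parts against the increasing kernel `(t - s)^(-α)`
gives `Γ(1-α) ∂_t^α f(t) ≤ t^(-α) (f t - f 0)`. Inserting the equation yields `f 0 ≤ (1 + l Γ(1-α)
t^α) f t`; minimising over an interval gives the bound at its right endpoint
(`IsScalarSolution.le_mul`).

Testing the equation against `e = P_l u(0)` turns this into `‖P_l u(0)‖ ≤ C max(1, κ + l) ‖P_l
u(T)‖` (`IsSolution.norm_eigenProj_le`). The compact resolvent makes the eigenspaces total, so
Parseval holds, and Hölder's inequality interpolates between the graph-norm bound on `u(0)` and the
norm of `u(T)` (`le_rpow_mul_rpow_of_hasSum`). -/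

namespace CaputoBackward

/-! ### Extremum principle for the Caputo integral -/

/-- Integration by parts against a nonnegative increasing kernel, for an absolutely continuous
function that is minimal at the right endpoint. -/
lemma integral_shifted_kernel_le {α t δ : ℝ} (hα : 0 < α) (ht : 0 < t) (hδ : 0 < δ) {φ : ℝ → ℝ}
    (hφ : IntervalIntegrable φ volume 0 t)
    (hmin : ∀ s ∈ Icc 0 t, ∫ r in (0 : ℝ)..t, φ r ≤ ∫ r in (0 : ℝ)..s, φ r) :
    ∫ s in (0 : ℝ)..t, (t - s + δ) ^ (-α) * φ s ≤ (t + δ) ^ (-α) * ∫ s in (0 : ℝ)..t, φ s := by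
  set F : ℝ → ℝ := fun s => ∫ r in (0 : ℝ)..s, φ r with hF
  set k : ℝ → ℝ := fun s => (t - s + δ) ^ (-α) with hk
  have hFac : AbsolutelyContinuousOnInterval F 0 t :=
    hφ.absolutelyContinuousOnInterval_intervalIntegral (by simp)
  have hpos : ∀ s ∈ uIcc 0 t, 0 < t - s + δ := by
    intro s hs
    rw [uIcc_of_le ht.le] at hs
    linarith [hs.2]
  have hkd : ∀ s ∈ uIcc 0 t, HasDerivAt k (α * (t - s + δ) ^ (-α - 1)) s := by
    intro s hs
    have h1 : HasDerivAt (fun s : ℝ => t - s + δ) (-1) s := by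
      simpa using ((hasDerivAt_id s).const_sub t).add_const δ
    convert h1.rpow_const (p := -α) (Or.inl (hpos s hs).ne') using 1
    ring
  have hcont : ContinuousOn (fun s => t - s + δ) (uIcc 0 t) := by fun_prop
  have hkC : ContDiffOn ℝ 1 k (uIcc 0 t) := by
    apply ContDiffOn.rpow_const_of_ne
    · fun_prop
    · exact fun s hs => (hpos s hs).ne'
  have hkac : AbsolutelyContinuousOnInterval k 0 t := hkC.absolutelyContinuousOnInterval
  have hparts := hkac.integral_mul_deriv_eq_deriv_mul hFac
  have hae : ∫ s in (0 : ℝ)..t, k s * deriv F s = ∫ s in (0 : ℝ)..t, k s * φ s := by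
    apply intervalIntegral.integral_congr_ae
    filter_upwards [hφ.ae_hasDerivAt_integral] with s hs hs'
    rw [(hs (uIoc_subset_uIcc hs') 0 (by simp)).deriv]
  have hk'int : IntervalIntegrable (deriv k) volume 0 t := hkac.intervalIntegrable_deriv
  -- Since `k' ≥ 0` and `F` is minimal at `t`, replacing `F s` by `F t` in the integration by parts
  -- leaves `k t F t - (k t - k 0) F t = k 0 F t`.
  have hle : ∫ s in (0 : ℝ)..t, deriv k s * F t ≤ ∫ s in (0 : ℝ)..t, deriv k s * F s := by
    apply intervalIntegral.integral_mono_on ht.le (hk'int.mul_const _)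
      (hk'int.mul_continuousOn hFac.continuousOn)
    intro s hs
    have hs' : s ∈ uIcc 0 t := by rwa [uIcc_of_le ht.le]
    rw [(hkd s hs').deriv]
    exact mul_le_mul_of_nonneg_left (hmin s hs)
      (mul_nonneg hα.le (Real.rpow_nonneg (hpos s hs').le _))
  rw [intervalIntegral.integral_mul_const, hkac.integral_deriv_eq_sub] at hle
  have hF0 : F 0 = 0 := by simp [hF]
  have hk0 : k 0 = (t + δ) ^ (-α) := by simp [hk]
  rw [hae, hF0] at hparts
  rw [← hk0]
  change ∫ s in (0 : ℝ)..t, k s * φ s ≤ k 0 * F t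
  linarith

/-- The extremum principle for the Caputo integral at a running minimum. -/
lemma integral_kernel_le {α t : ℝ} (hα : 0 < α) (ht : 0 < t) {φ : ℝ → ℝ}
    (hφ : IntervalIntegrable φ volume 0 t)
    (hint : IntervalIntegrable (fun s => (t - s) ^ (-α) * φ s) volume 0 t)
    (hmin : ∀ s ∈ Icc 0 t, ∫ r in (0 : ℝ)..t, φ r ≤ ∫ r in (0 : ℝ)..s, φ r) :
    ∫ s in (0 : ℝ)..t, (t - s) ^ (-α) * φ s ≤ t ^ (-α) * ∫ s in (0 : ℝ)..t, φ s := by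
  have hne : ∀ᵐ s : ℝ, s ≠ t := by simp [ae_iff, measure_singleton]
  have hev : ∀ᶠ δ : ℝ in 𝓝[>] 0, 0 < δ := self_mem_nhdsWithin
  -- The shift by `δ` removes the singularity at `s = t`. As `-α < 0`, the shifted kernel is
  -- dominated by the original one, so `δ → 0` is dominated convergence.
  have hlim : Tendsto (fun δ : ℝ => ∫ s in (0 : ℝ)..t, (t - s + δ) ^ (-α) * φ s) (𝓝[>] 0)
      (𝓝 (∫ s in (0 : ℝ)..t, (t - s) ^ (-α) * φ s)) := by
    apply intervalIntegral.tendsto_integral_filter_of_dominated_convergence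
      (fun s => |(t - s) ^ (-α) * φ s|)
    · refine Eventually.of_forall fun δ => ?_
      refine AEStronglyMeasurable.mul ?_ hφ.aestronglyMeasurable_restrict_uIoc
      exact (Measurable.pow_const (by fun_prop) _).aestronglyMeasurable
    · filter_upwards [hev] with δ hδ
      filter_upwards [hne] with s hs hs'
      rw [uIoc_of_le ht.le] at hs'
      have h1 : 0 < t - s := sub_pos.2 (lt_of_le_of_ne hs'.2 hs)
      rw [Real.norm_eq_abs, abs_mul, abs_mul]
      refine mul_le_mul_of_nonneg_right ?_ (abs_nonneg _)
      rw [abs_of_nonneg (by positivity), abs_of_nonneg (by positivity)]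
      exact Real.rpow_le_rpow_of_nonpos h1 (by linarith) (by linarith)
    · exact hint.abs
    · filter_upwards [hne] with s hs hs'
      rw [uIoc_of_le ht.le] at hs'
      have h1 : 0 < t - s := sub_pos.2 (lt_of_le_of_ne hs'.2 hs)
      refine Tendsto.mul_const _ (tendsto_nhdsWithin_of_tendsto_nhds ?_)
      have h2 : ContinuousAt (fun δ : ℝ => (t - s + δ) ^ (-α)) 0 :=
        ContinuousAt.rpow_const (by fun_prop) (Or.inl (by simpa using h1.ne'))
      simpa [ContinuousAt] using h2
  have hlim' : Tendsto (fun δ : ℝ => (t + δ) ^ (-α) * ∫ s in (0 : ℝ)..t, φ s) (𝓝[>] 0)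
      (𝓝 (t ^ (-α) * ∫ s in (0 : ℝ)..t, φ s)) := by
    refine Tendsto.mul_const _ (tendsto_nhdsWithin_of_tendsto_nhds ?_)
    have h2 : ContinuousAt (fun δ : ℝ => (t + δ) ^ (-α)) 0 :=
      ContinuousAt.rpow_const (by fun_prop) (Or.inl (by simpa using ht.ne'))
    simpa [ContinuousAt] using h2
  refine le_of_tendsto_of_tendsto hlim hlim' ?_
  filter_upwards [hev] with δ hδ
  exact integral_shifted_kernel_le hα ht hδ hφ hmin

/-! ### Lower bound for the scalar fractional equation -/

/-- `f` solves the scalar equation `∂_t^α f = -l f` on `(0, T)`, with `f' = φ`. -/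
structure IsScalarSolution (α T l : ℝ) (f φ : ℝ → ℝ) : Prop where
  continuousOn : ContinuousOn f (Icc 0 T)
  integrable : ∀ t ∈ Ioo 0 T, IntervalIntegrable φ volume 0 t
  eq_integral : ∀ t ∈ Ioo 0 T, f t = f 0 + ∫ s in (0 : ℝ)..t, φ s
  kernel_integrable : ∀ t ∈ Ioo 0 T,
    IntervalIntegrable (fun s => (t - s) ^ (-α) * φ s) volume 0 t
  equation : ∀ t ∈ Ioo 0 T,
    (Real.Gamma (1 - α))⁻¹ * ∫ s in (0 : ℝ)..t, (t - s) ^ (-α) * φ s = -l * f t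

lemma IsScalarSolution.neg_mul_le_of_runningMin {α T l : ℝ} {f φ : ℝ → ℝ}
    (h : IsScalarSolution α T l f φ) (hα : 0 < α) (hα' : α < 1) {t : ℝ} (ht : t ∈ Ioo 0 T)
    (hmin : ∀ s ∈ Icc 0 t, f t ≤ f s) :
    -l * (Real.Gamma (1 - α) * t ^ α) * f t ≤ f t - f 0 := by
  have hΓ : 0 < Real.Gamma (1 - α) := Real.Gamma_pos_of_pos (by linarith)
  have hval : ∀ s ∈ Icc 0 t, f s = f 0 + ∫ r in (0 : ℝ)..s, φ r := by
    intro s hs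
    rcases hs.1.eq_or_lt with rfl | hs0
    · simp
    · exact h.eq_integral s ⟨hs0, hs.2.trans_lt ht.2⟩
  have htt : t ∈ Icc 0 t := ⟨ht.1.le, le_rfl⟩
  have hker := integral_kernel_le hα ht.1 (h.integrable t ht) (h.kernel_integrable t ht)
    (fun s hs => by have := hmin s hs; rw [hval s hs, hval t htt] at this; linarith)
  have heq := h.equation t ht
  rw [inv_mul_eq_iff_eq_mul₀ hΓ.ne'] at heq
  have hF : ∫ s in (0 : ℝ)..t, φ s = f t - f 0 := by rw [hval t htt]; ring
  rw [heq, hF] at hker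
  have htα : 0 < t ^ α := Real.rpow_pos_of_pos ht.1 _
  have := mul_le_mul_of_nonneg_left hker htα.le
  rw [Real.rpow_neg ht.1.le, mul_inv_cancel_left₀ htα.ne'] at this
  linarith

/-- The running-minimum inequality is applied where `f` attains its minimum over `[0, t]`. Enlarging
`l` to `max l 0` and the time to `T` requires `f` to be positive there: for `l ≥ 0` the inequality
itself forces this, for `l < 0` it needs a separate argument. -/
lemma IsScalarSolution.le_mul_of_lt {α T l : ℝ} {f φ : ℝ → ℝ}
    (h : IsScalarSolution α T l f φ) (hα : 0 < α) (hα' : α < 1) (h0 : 0 < f 0) {t : ℝ}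
    (ht : t ∈ Ioo 0 T) :
    f 0 ≤ (1 + max l 0 * (Real.Gamma (1 - α) * T ^ α)) * f t := by
  have hΓ : 0 < Real.Gamma (1 - α) := Real.Gamma_pos_of_pos (by linarith)
  have hT : 0 < T := ht.1.trans ht.2
  have hgrow : ∀ s ∈ Ioo 0 T, (Real.Gamma (1 - α) * s ^ α) ≤ (Real.Gamma (1 - α) * T ^ α) := by
    intro s hs
    exact mul_le_mul_of_nonneg_left (Real.rpow_le_rpow hs.1.le hs.2.le hα.le) hΓ.le
  have hsub : Icc 0 t ⊆ Icc 0 T := Icc_subset_Icc_right ht.2.le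
  have hfc : ContinuousOn f (Icc 0 t) := h.continuousOn.mono hsub
  have key : ∀ s ∈ Icc 0 t, (∀ r ∈ Icc 0 s, f s ≤ f r) → (0 < f s ∨ 0 ≤ l) →
      f 0 ≤ (1 + max l 0 * (Real.Gamma (1 - α) * T ^ α)) * f s ∧ 0 < f s := by
    intro s hs hmin hor
    have hTα : 0 ≤ Real.Gamma (1 - α) * T ^ α := by positivity
    rcases hs.1.eq_or_lt with rfl | hs0
    · refine ⟨?_, h0⟩
      have : 0 ≤ max l 0 * (Real.Gamma (1 - α) * T ^ α) := mul_nonneg (le_max_right _ _) hTα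
      nlinarith
    · have hsT : s ∈ Ioo 0 T := ⟨hs0, hs.2.trans_lt ht.2⟩
      have hb := h.neg_mul_le_of_runningMin hα hα' hsT hmin
      have hg := hgrow s hsT
      have hg0 : 0 ≤ Real.Gamma (1 - α) * s ^ α := by positivity
      set a := Real.Gamma (1 - α) * s ^ α
      set b := Real.Gamma (1 - α) * T ^ α
      have hpos : 0 < f s := by
        rcases hor with hor | hl
        · exact hor
        · have h1 : 0 ≤ l * a := mul_nonneg hl hg0
          by_contra hc
          push Not at hc
          nlinarith
      refine ⟨?_, hpos⟩
      have h2 : l * a ≤ max l 0 * b :=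
        (mul_le_mul_of_nonneg_right (le_max_left l 0) hg0).trans
          (mul_le_mul_of_nonneg_left hg (le_max_right l 0))
      nlinarith [mul_le_mul_of_nonneg_right h2 hpos.le]
  -- Otherwise `f` reaches `f 0 / 2` at a first time `m`. This is a running minimum with positive
  -- value, and for `l < 0` the factor in `key` is `1`, so `f 0 ≤ f m ≤ f 0 / 2`, a contradiction.
  have hpos : l < 0 → ∀ s ∈ Icc 0 t, 0 < f s := by
    intro hl
    by_contra! hc
    obtain ⟨s, hs, hfs⟩ := hc
    set S : Set ℝ := Icc 0 t ∩ f ⁻¹' (Iic (f 0 / 2)) with hS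
    have hSc : IsClosed S := hfc.preimage_isClosed_of_isClosed isClosed_Icc isClosed_Iic
    have hSne : S.Nonempty := ⟨s, hs, by simp only [mem_preimage, mem_Iic]; linarith⟩
    have hSb : BddBelow S := ⟨0, fun x hx => hx.1.1⟩
    have hm := hSc.csInf_mem hSne hSb
    set m := sInf S
    have hbefore : ∀ r ∈ Ico 0 m, f 0 / 2 < f r := by
      intro r hr
      by_contra hcc
      push Not at hcc
      exact absurd (csInf_le hSb ⟨⟨hr.1, hr.2.le.trans hm.1.2⟩, hcc⟩) (not_le.2 hr.2)
    have hfm : f m ≤ f 0 / 2 := hm.2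
    have hm0 : 0 < m := by
      rcases hm.1.1.eq_or_lt with h' | h'
      · rw [← h'] at hfm; linarith
      · exact h'
    have hfm' : f 0 / 2 ≤ f m := by
      have hcw : ContinuousWithinAt f (Ico 0 m) m :=
        (hfc m hm.1).mono (fun r hr => ⟨hr.1, hr.2.le.trans hm.1.2⟩)
      have : (𝓝[Ico 0 m] m).NeBot := by
        rw [← mem_closure_iff_nhdsWithin_neBot, closure_Ico hm0.ne]
        exact ⟨hm0.le, le_rfl⟩
      exact ge_of_tendsto hcw (eventually_nhdsWithin_of_forall fun r hr => (hbefore r hr).le)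
    have hk := (key m hm.1 (fun r hr => by
      rcases hr.2.eq_or_lt with h' | h'
      · rw [h']
      · exact hfm.trans (hbefore r ⟨hr.1, h'⟩).le) (Or.inl (by linarith))).1
    rw [max_eq_right hl.le] at hk
    linarith
  obtain ⟨s, hs, hsmin⟩ := isCompact_Icc.exists_isMinOn ⟨t, ⟨ht.1.le, le_rfl⟩⟩ hfc
  have hk := (key s hs (fun r hr => hsmin ⟨hr.1, hr.2.trans hs.2⟩) (by
    rcases lt_or_ge l 0 with hl | hl
    · exact Or.inl (hpos hl s hs)
    · exact Or.inr hl)).1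
  refine hk.trans (mul_le_mul_of_nonneg_left (hsmin ⟨ht.1.le, le_rfl⟩) ?_)
  have : 0 ≤ max l 0 := le_max_right _ _
  positivity

/-- The lower bound `f 0 / (1 + l⁺ Γ(1 - α) T^α) ≤ f T` for the scalar equation. -/
theorem IsScalarSolution.le_mul {α T l : ℝ} {f φ : ℝ → ℝ}
    (h : IsScalarSolution α T l f φ) (hα : 0 < α) (hα' : α < 1) (hT : 0 < T) (h0 : 0 < f 0) :
    f 0 ≤ (1 + max l 0 * (Real.Gamma (1 - α) * T ^ α)) * f T := by
  have hcw : ContinuousWithinAt f (Ioo 0 T) T :=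
    (h.continuousOn T ⟨hT.le, le_rfl⟩).mono Ioo_subset_Icc_self
  have : (𝓝[Ioo 0 T] T).NeBot := by
    rw [← mem_closure_iff_nhdsWithin_neBot, closure_Ioo hT.ne]
    exact ⟨hT.le, le_rfl⟩
  -- The equation is only available for `t < T`; continuity carries the bound to `T`.
  exact ge_of_tendsto (hcw.const_smul (1 + max l 0 * (Real.Gamma (1 - α) * T ^ α)))
    (eventually_nhdsWithin_of_forall fun t ht => h.le_mul_of_lt hα hα' h0 ht)

end CaputoBackward

/-! ### Bessel and Parseval for orthogonal families of subspaces -/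

section OrthogonalFamily

variable {𝕜 E ι : Type*} [RCLike 𝕜] [NormedAddCommGroup E] [InnerProductSpace 𝕜 E]
  {V : ι → Submodule 𝕜 E} [∀ i, (V i).HasOrthogonalProjection]

lemma Submodule.inner_starProjection_right_self (K : Submodule 𝕜 E) [K.HasOrthogonalProjection]
    (x : E) : ⟪x, K.starProjection x⟫_𝕜 = ((‖K.starProjection x‖ ^ 2 : ℝ) : 𝕜) := by
  rw [← K.starProjection_eq_self_iff.2 (K.starProjection_apply_mem x),
    ← K.inner_starProjection_left_eq_right, K.starProjection_eq_self_iff.2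
      (K.starProjection_apply_mem x), inner_self_eq_norm_sq_to_K]
  norm_cast

/-- **Bessel's inequality** for an orthogonal family of subspaces. -/
lemma OrthogonalFamily.sum_norm_sq_starProjection_le
    (hV : OrthogonalFamily 𝕜 (fun i => V i) fun i => (V i).subtypeₗᵢ) (x : E) (s : Finset ι) :
    ∑ i ∈ s, ‖(V i).starProjection x‖ ^ 2 ≤ ‖x‖ ^ 2 := by
  set y := ∑ i ∈ s, (V i).starProjection x with hy
  have h1 : ‖y‖ ^ 2 = ∑ i ∈ s, ‖(V i).starProjection x‖ ^ 2 :=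
    hV.norm_sum (fun i => ⟨(V i).starProjection x, (V i).starProjection_apply_mem x⟩) s
  have h2 : RCLike.re ⟪x, y⟫_𝕜 = ‖y‖ ^ 2 := by
    rw [h1, hy, _root_.inner_sum, map_sum]
    exact Finset.sum_congr rfl fun i _ => by
      rw [(V i).inner_starProjection_right_self, RCLike.ofReal_re]
  have h3 : ‖y‖ ^ 2 ≤ ‖x‖ * ‖y‖ := h2 ▸ re_inner_le_norm x y
  rw [← h1]
  nlinarith [norm_nonneg x, norm_nonneg y, sq_nonneg (‖x‖ - ‖y‖)]

lemma OrthogonalFamily.summable_norm_sq_starProjection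
    (hV : OrthogonalFamily 𝕜 (fun i => V i) fun i => (V i).subtypeₗᵢ) (x : E) :
    Summable fun i => ‖(V i).starProjection x‖ ^ 2 :=
  summable_of_sum_le (fun _ => sq_nonneg _) (hV.sum_norm_sq_starProjection_le x)

lemma OrthogonalFamily.starProjection_apply_of_ne
    (hV : OrthogonalFamily 𝕜 (fun i => V i) fun i => (V i).subtypeₗᵢ) {i j : ι} (hij : i ≠ j)
    {x : E} (hx : x ∈ V j) : (V i).starProjection x = 0 := by
  rw [(V i).starProjection_apply_eq_zero_iff, Submodule.mem_orthogonal]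
  exact fun v hv => hV hij ⟨v, hv⟩ ⟨x, hx⟩

/-- **Parseval's identity** for a total orthogonal family of subspaces. -/
lemma OrthogonalFamily.hasSum_norm_sq_starProjection [CompleteSpace E]
    (hV : OrthogonalFamily 𝕜 (fun i => V i) fun i => (V i).subtypeₗᵢ)
    (htot : ∀ x : E, (∀ i, ∀ v ∈ V i, ⟪v, x⟫_𝕜 = 0) → x = 0) (x : E) :
    HasSum (fun i => ‖(V i).starProjection x‖ ^ 2) (‖x‖ ^ 2) := by
  have hsum : Summable fun i => (V i).starProjection x :=
    (hV.summable_iff_norm_sq_summable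
      (fun i => ⟨(V i).starProjection x, (V i).starProjection_apply_mem x⟩)).2
      (hV.summable_norm_sq_starProjection x)
  obtain ⟨y, hy⟩ := hsum
  -- The sum `y` of the projections has the same components as `x`, so `y - x` is orthogonal to
  -- every `V j` and vanishes by totality.
  have hproj : ∀ j, (V j).starProjection y = (V j).starProjection x := by
    intro j
    have h1 := hy.mapL ((V j).starProjection)
    refine h1.unique ?_
    convert! hasSum_single (α := E) j fun i hi => ?_ using 1
    · exact ((V j).starProjection_eq_self_iff.2 ((V j).starProjection_apply_mem x)).symm
    · exact hV.starProjection_apply_of_ne hi.symm ((V i).starProjection_apply_mem x)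
  have hxy : y = x := by
    rw [← sub_eq_zero]
    refine htot _ fun i v hv => ?_
    have : (V i).starProjection (y - x) = 0 := by rw [map_sub, hproj, sub_self]
    rw [(V i).starProjection_apply_eq_zero_iff, Submodule.mem_orthogonal] at this
    exact this v hv
  rw [hxy] at hy
  have h2 := (hy.mapL (innerSL 𝕜 x)).mapL (RCLike.reCLM (K := 𝕜))
  simp only [innerSL_apply_apply, RCLike.reCLM_apply, inner_self_eq_norm_sq] at h2
  convert! h2 using 2 with i
  rw [(V i).inner_starProjection_right_self, RCLike.ofReal_re]

end OrthogonalFamily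

/-! ### Spectral decomposition of the operator -/

namespace CaputoBackward

variable {𝕜 H : Type*} [RCLike 𝕜] [NormedAddCommGroup H] [InnerProductSpace 𝕜 H]
  {A : H →ₗ.[𝕜] H}

/-- From `R x = μ x` follows `-A x = (μ⁻¹ - l) x`. Symmetry makes `μ` real, and injectivity of the
resolvent makes it nonzero. -/
lemma IsResolventAt.exists_mem_negEigenspace {l : ℝ} {R : H →L[𝕜] H}
    (hR : IsResolventAt A l R) (hsymm : (R : H →ₗ[𝕜] H).IsSymmetric) (μ : 𝕜) {x : H}
    (hx : x ∈ Module.End.eigenspace (R : H →ₗ[𝕜] H) μ) : ∃ m : ℝ, x ∈ negEigenspace A m := by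
  rcases eq_or_ne x 0 with rfl | hx0
  · exact ⟨0, zero_mem _⟩
  have hRx : R x = μ • x := Module.End.mem_eigenspace_iff.1 hx
  have hμ : ((RCLike.re μ : ℝ) : 𝕜) = μ :=
    RCLike.conj_eq_iff_re.1 (hsymm.conj_eigenvalue_eq_self
      (Module.End.hasEigenvalue_of_hasEigenvector ⟨hx, hx0⟩))
  obtain ⟨h, hx'⟩ := hR.1 x
  have hμ0 : μ ≠ 0 := by
    rintro rfl
    rw [zero_smul] at hRx
    have h2 : (⟨R x, h⟩ : A.domain) = 0 := Subtype.ext hRx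
    rw [h2, LinearPMap.map_zero, hRx] at hx'
    simp at hx'
    exact hx0 hx'.symm
  have hd : x ∈ A.domain := by
    rw [hRx] at h
    simpa [smul_smul, inv_mul_cancel₀ hμ0] using A.domain.smul_mem μ⁻¹ h
  have h2 : (⟨R x, h⟩ : A.domain) = μ • ⟨x, hd⟩ := Subtype.ext hRx
  rw [h2, LinearPMap.map_smul, hRx, smul_comm, ← smul_sub] at hx'
  refine ⟨(RCLike.re μ)⁻¹ - l, hd, ?_⟩
  have h3 : (l : 𝕜) • x - A ⟨x, hd⟩ = μ⁻¹ • x := by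
    conv_rhs => rw [← hx']
    rw [smul_smul, inv_mul_cancel₀ hμ0, one_smul]
  have h4 : (((RCLike.re μ)⁻¹ - l : ℝ) : 𝕜) = μ⁻¹ - l := by
    rw [RCLike.ofReal_sub, RCLike.ofReal_inv, hμ]
  rw [h4, sub_smul, ← h3]
  abel

variable [CompleteSpace H] {κ : ℝ}

lemma StandingAssumption.inner_apply_comm (hA : StandingAssumption A κ) (x y : A.domain) :
    ⟪A x, (y : H)⟫_𝕜 = ⟪(x : H), A y⟫_𝕜 := by
  have h := A.adjoint_isFormalAdjoint hA.selfAdjoint.dense_domain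
  rw [LinearPMap.isSelfAdjoint_def.1 hA.selfAdjoint] at h
  exact h x y

/-- Both sides are continuous in `e`, so symmetry of `A` on the eigenspace extends to its closure;
closedness of the eigenspace is not needed. -/
lemma StandingAssumption.inner_apply_of_mem (hA : StandingAssumption A κ) {l : ℝ} {e : H}
    (he : e ∈ (negEigenspace A l).topologicalClosure) (x : A.domain) :
    ⟪e, A x⟫_𝕜 = -(l : 𝕜) * ⟪e, (x : H)⟫_𝕜 := by
  have hcl : IsClosed {e : H | ⟪e, A x⟫_𝕜 = -(l : 𝕜) * ⟪e, (x : H)⟫_𝕜} :=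
    isClosed_eq (by fun_prop) (by fun_prop)
  refine closure_minimal ?_ hcl he
  rintro e ⟨hd, hl⟩
  change ⟪e, A x⟫_𝕜 = _
  rw [neg_eq_iff_eq_neg] at hl
  rw [← hA.inner_apply_comm ⟨e, hd⟩ x, hl, inner_neg_left, inner_smul_left, RCLike.conj_ofReal,
    neg_mul]

lemma StandingAssumption.orthogonalFamily (hA : StandingAssumption A κ) :
    OrthogonalFamily 𝕜 (fun l : ℝ => (negEigenspace A l).topologicalClosure)
      fun l => ((negEigenspace A l).topologicalClosure).subtypeₗᵢ := by
  rintro l m hlm ⟨e, he⟩ ⟨f, hf⟩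
  change ⟪e, f⟫_𝕜 = 0
  have hcl : IsClosed {f : H | ⟪e, f⟫_𝕜 = 0} := isClosed_eq (by fun_prop) (by fun_prop)
  refine closure_minimal ?_ hcl hf
  rintro f ⟨hd, hm⟩
  have h := hA.inner_apply_of_mem he ⟨f, hd⟩
  rw [neg_eq_iff_eq_neg] at hm
  rw [hm, inner_neg_right, inner_smul_right, neg_mul, neg_inj] at h
  have h' : ((m : 𝕜) - l) * ⟪e, f⟫_𝕜 = 0 := by rw [sub_mul, h, sub_self]
  refine (mul_eq_zero.1 h').resolve_left fun h0 => hlm ?_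
  exact_mod_cast (sub_eq_zero.1 h0).symm

/-- Totality comes from the spectral theorem for the compact resolvent, which is symmetric because
`A` is and whose eigenvectors are eigenvectors of `-A`. -/
lemma StandingAssumption.eq_zero_of_inner_eq_zero (hA : StandingAssumption A κ) {x : H}
    (hx : ∀ l : ℝ, ∀ v ∈ (negEigenspace A l).topologicalClosure, ⟪v, x⟫_𝕜 = 0) : x = 0 := by
  obtain ⟨l, -, R, hR, hcomp⟩ := hA.compactResolvent
  have hsymm : (R : H →ₗ[𝕜] H).IsSymmetric := by
    intro x y
    obtain ⟨hx, ex⟩ := hR.1 x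
    obtain ⟨hy, ey⟩ := hR.1 y
    change ⟪R x, y⟫_𝕜 = ⟪x, R y⟫_𝕜
    have h := hA.inner_apply_comm ⟨R x, hx⟩ ⟨R y, hy⟩
    conv_lhs => rw [← ey]
    conv_rhs => rw [← ex]
    rw [inner_sub_left, inner_sub_right, inner_smul_left, inner_smul_right, RCLike.conj_ofReal, h]
  have hbot := ContinuousLinearMap.orthogonalComplement_iSup_eigenspaces_eq_bot hcomp hsymm
  rw [← Submodule.mem_bot 𝕜, ← hbot, Submodule.mem_orthogonal]
  intro v hv
  induction hv using Submodule.iSup_induction' with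
  | mem μ v hv =>
    obtain ⟨m, hm⟩ := hR.exists_mem_negEigenspace hsymm μ hv
    exact hx m v (Submodule.le_topologicalClosure _ hm)
  | zero => exact inner_zero_left _
  | add u v _ _ hu hv => rw [inner_add_left, hu, hv, add_zero]

lemma StandingAssumption.negEigenspace_eq_bot (hA : StandingAssumption A κ) {l : ℝ}
    (hl : κ + l < 0) : negEigenspace A l = ⊥ := by
  rw [Submodule.eq_bot_iff]
  rintro x ⟨hd, hx⟩
  rw [neg_eq_iff_eq_neg] at hx
  have h := hA.boundedAbove ⟨x, hd⟩
  rw [hx, inner_neg_left, inner_smul_left, RCLike.conj_ofReal, map_neg, RCLike.re_ofReal_mul,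
    inner_self_eq_norm_sq] at h
  by_contra hx0
  have : 0 < ‖x‖ ^ 2 := by positivity
  simp only at h
  nlinarith

/-- Negative bases `κ + l` meet only zero projections, so the value of a real power at a negative
base never matters. -/
lemma StandingAssumption.eigenProj_eq_zero (hA : StandingAssumption A κ) {l : ℝ}
    (hl : κ + l < 0) (x : H) : eigenProj A l x = 0 := by
  have h : eigenProj A l x ∈ (negEigenspace A l).topologicalClosure :=
    Submodule.starProjection_apply_mem _ x
  have hcl : (negEigenspace A l).topologicalClosure = ⊥ := by
    rw [hA.negEigenspace_eq_bot hl]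
    exact (isClosed_singleton).submodule_topologicalClosure_eq
  rw [hcl] at h
  exact (Submodule.mem_bot 𝕜).1 h

lemma StandingAssumption.hasSum_norm_sq_eigenProj (hA : StandingAssumption A κ) (x : H) :
    HasSum (fun l : ℝ => ‖eigenProj A l x‖ ^ 2) (‖x‖ ^ 2) :=
  hA.orthogonalFamily.hasSum_norm_sq_starProjection (fun _ => hA.eq_zero_of_inner_eq_zero) x

lemma StandingAssumption.norm_sq_eigenProj_smul (hA : StandingAssumption A κ) (ε l : ℝ) (x : H) :
    ‖(((κ + l) ^ ε : ℝ) : 𝕜) • eigenProj A l x‖ ^ 2 =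
      (κ + l) ^ (2 * ε) * ‖eigenProj A l x‖ ^ 2 := by
  rcases lt_or_ge (κ + l) 0 with h | h
  · simp [hA.eigenProj_eq_zero h]
  · rw [norm_smul, mul_pow, RCLike.norm_ofReal, sq_abs, mul_comm 2 ε, Real.rpow_mul h,
      Real.rpow_two]

/-- The norm of the spectral fractional power dominates its spectral expansion. -/
lemma StandingAssumption.sum_le_norm_sq_fracPow (hA : StandingAssumption A κ) {ε : ℝ} {x : H}
    (hx : x ∈ fracPowDomain A κ ε) (s : Finset ℝ) :
    ∑ l ∈ s, (κ + l) ^ (2 * ε) * ‖eigenProj A l x‖ ^ 2 ≤ ‖fracPow A κ ε x‖ ^ 2 := by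
  have hmem : ∀ l : ℝ, (((κ + l) ^ ε : ℝ) : 𝕜) • eigenProj A l x ∈
      (negEigenspace A l).topologicalClosure := fun l =>
    Submodule.smul_mem _ _ (Submodule.starProjection_apply_mem _ x)
  have hsum : Summable fun l : ℝ => (((κ + l) ^ ε : ℝ) : 𝕜) • eigenProj A l x := by
    refine (hA.orthogonalFamily.summable_iff_norm_sq_summable (fun l => ⟨_, hmem l⟩)).2 ?_
    refine Summable.congr hx fun l => ?_
    exact (hA.norm_sq_eigenProj_smul ε l x).symm
  have hlim : Tendsto
      (fun F : Finset ℝ => ‖∑ l ∈ F, (((κ + l) ^ ε : ℝ) : 𝕜) • eigenProj A l x‖ ^ 2) atTop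
      (𝓝 (‖fracPow A κ ε x‖ ^ 2)) := (hsum.hasSum.norm).pow 2
  refine ge_of_tendsto hlim ?_
  filter_upwards [eventually_ge_atTop s] with F hF
  have h1 := hA.orthogonalFamily.norm_sum (fun l => ⟨_, hmem l⟩) F
  have h2 : ‖∑ l ∈ F, (((κ + l) ^ ε : ℝ) : 𝕜) • eigenProj A l x‖ ^ 2 =
      ∑ l ∈ F, (κ + l) ^ (2 * ε) * ‖eigenProj A l x‖ ^ 2 := by
    refine h1.trans (Finset.sum_congr rfl fun l _ => ?_)
    exact hA.norm_sq_eigenProj_smul ε l x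
  rw [h2]
  refine Finset.sum_le_sum_of_subset_of_nonneg hF fun l _ _ => ?_
  rw [← hA.norm_sq_eigenProj_smul ε l x]
  exact sq_nonneg _

/-- The weight must be at least `1` to absorb the constant term of the decay bound. The graph norm
still controls it with no extra constant, because `max 1 y ^ (2ε) ≤ 1 + y ^ (2ε)` for `y ≥ 0`. -/
lemma StandingAssumption.sum_max_rpow_le (hA : StandingAssumption A κ) {ε R : ℝ} {x : H}
    (hx : x ∈ admissibleSet A κ ε R) (hR : 0 ≤ R) (s : Finset ℝ) :
    ∑ l ∈ s, ‖eigenProj A l x‖ ^ 2 * max 1 (κ + l) ^ (2 * ε) ≤ R ^ 2 := by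
  have h1 := hA.sum_le_norm_sq_fracPow hx.1 s
  have h2 := sum_le_hasSum s (fun l _ => sq_nonneg _) (hA.hasSum_norm_sq_eigenProj x)
  have h3 : ‖x‖ ^ 2 + ‖fracPow A κ ε x‖ ^ 2 ≤ R ^ 2 := (Real.sqrt_le_left hR).1 hx.2
  refine le_trans ?_ ((add_le_add h2 h1).trans h3)
  rw [← Finset.sum_add_distrib]
  refine Finset.sum_le_sum fun l _ => ?_
  rcases lt_or_ge (κ + l) 0 with h | h
  · simp [hA.eigenProj_eq_zero h]
  · have h4 : 0 ≤ (κ + l) ^ (2 * ε) := Real.rpow_nonneg h _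
    have h5 : max 1 (κ + l) ^ (2 * ε) ≤ 1 + (κ + l) ^ (2 * ε) := by
      rcases max_cases 1 (κ + l) with ⟨hm, -⟩ | ⟨hm, -⟩ <;> rw [hm]
      · rw [Real.one_rpow]; linarith
      · linarith
    nlinarith [mul_le_mul_of_nonneg_left h5 (sq_nonneg ‖eigenProj A l x‖)]

/-! ### Hölder interpolation -/

/-- Interpolation between a weighted `ℓ²` bound and a lower bound, by Hölder's inequality. -/
lemma le_rpow_mul_rpow_of_hasSum {ι : Type*} {a b m : ι → ℝ} {C N R S ε β : ℝ}
    (ha : ∀ i, 0 ≤ a i) (hm : ∀ i, 0 < m i) (hC : 0 ≤ C) (hN : 0 ≤ N)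
    (hR : 0 ≤ R) (hS : 0 ≤ S) (hε : 0 < ε) (hβ : β = ε / (ε + 1))
    (hab : ∀ i, a i ≤ C * m i * b i)
    (hx : ∀ s : Finset ι, ∑ i ∈ s, a i ^ 2 * m i ^ (2 * ε) ≤ R ^ 2)
    (hy : ∀ s : Finset ι, ∑ i ∈ s, b i ^ 2 ≤ N ^ 2)
    (hsum : HasSum (fun i => a i ^ 2) (S ^ 2)) :
    S ≤ R ^ (1 - β) * (C * N) ^ β := by
  have hβ0 : 0 < β := by rw [hβ]; positivity
  have hβ1 : 0 < 1 - β := by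
    rw [hβ, sub_pos, div_lt_one (by positivity)]
    linarith
  -- This balance fixes `β`: the weight `m ^ (2β)` lost in the second Hölder factor is exactly `(m ^
  -- (2ε)) ^ (1 - β)`, available in the first.
  have hεβ : ε * (1 - β) = β := by
    rw [hβ]
    field_simp
    ring
  have hpq : ((1 - β)⁻¹).HolderConjugate β⁻¹ := Real.HolderConjugate.inv_inv hβ1 hβ0 (by ring)
  have hX : ∀ i, 0 ≤ a i ^ 2 * m i ^ (2 * ε) := fun i =>
    mul_nonneg (sq_nonneg _) (Real.rpow_nonneg (hm i).le _)
  have hterm : ∀ i, a i ^ 2 ≤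
      (a i ^ 2 * m i ^ (2 * ε)) ^ (1 - β) * (C ^ 2 * b i ^ 2) ^ β := by
    intro i
    have h1 : (m i ^ (2 * ε)) ^ (1 - β) = (m i ^ 2) ^ β := by
      rw [← Real.rpow_mul (hm i).le, mul_assoc, hεβ, Real.rpow_mul (hm i).le, Real.rpow_two]
    rw [Real.mul_rpow (sq_nonneg _) (Real.rpow_nonneg (hm i).le _), h1, mul_assoc,
      ← Real.mul_rpow (sq_nonneg _) (by positivity)]
    have h2 : a i ^ 2 ≤ m i ^ 2 * (C ^ 2 * b i ^ 2) :=
      (pow_le_pow_left₀ (ha i) (hab i) 2).trans_eq (by ring)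
    calc a i ^ 2 = (a i ^ 2) ^ (1 - β) * (a i ^ 2) ^ β := by
          rw [← Real.rpow_add_of_nonneg (sq_nonneg _) hβ1.le hβ0.le, sub_add_cancel,
            Real.rpow_one]
      _ ≤ _ := mul_le_mul_of_nonneg_left (Real.rpow_le_rpow (sq_nonneg _) h2 hβ0.le)
          (Real.rpow_nonneg (sq_nonneg _) _)
  have hfin : ∀ s : Finset ι, ∑ i ∈ s, a i ^ 2 ≤ (R ^ 2) ^ (1 - β) * ((C * N) ^ 2) ^ β := by
    intro s
    refine (Finset.sum_le_sum fun i _ => hterm i).trans ?_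
    refine (Real.inner_le_Lp_mul_Lq_of_nonneg s hpq
      (fun i _ => Real.rpow_nonneg (hX i) _)
      (fun i _ => Real.rpow_nonneg (by positivity) _)).trans ?_
    have e1 : ∀ i, ((a i ^ 2 * m i ^ (2 * ε)) ^ (1 - β)) ^ (1 - β)⁻¹ = a i ^ 2 * m i ^ (2 * ε) :=
      fun i => Real.rpow_rpow_inv (hX i) hβ1.ne'
    have e2 : ∀ i, ((C ^ 2 * b i ^ 2) ^ β) ^ β⁻¹ = C ^ 2 * b i ^ 2 :=
      fun i => Real.rpow_rpow_inv (by positivity) hβ0.ne'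
    simp only [e1, e2, one_div, inv_inv]
    refine mul_le_mul (Real.rpow_le_rpow (Finset.sum_nonneg fun i _ => hX i) (hx s) hβ1.le)
      (Real.rpow_le_rpow (Finset.sum_nonneg fun i _ => by positivity) ?_ hβ0.le)
      (Real.rpow_nonneg (Finset.sum_nonneg fun i _ => by positivity) _) (by positivity)
    rw [← Finset.mul_sum, mul_pow]
    exact mul_le_mul_of_nonneg_left (hy s) (sq_nonneg _)
  have hfinal : S ^ 2 ≤ (R ^ (1 - β) * (C * N) ^ β) ^ 2 := by
    refine (hasSum_le_of_sum_le hsum hfin).trans_eq ?_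
    have hCN : 0 ≤ C * N := mul_nonneg hC hN
    rw [mul_pow (R ^ (1 - β)), ← Real.rpow_two, ← Real.rpow_two, ← Real.rpow_two, ← Real.rpow_two,
      ← Real.rpow_mul hR, ← Real.rpow_mul hR, ← Real.rpow_mul hCN, ← Real.rpow_mul hCN,
      mul_comm 2, mul_comm 2]
  exact (pow_le_pow_iff_left₀ hS (by positivity) two_ne_zero).1 hfinal

/-! ### Spectral components of a solution -/

variable [NormedSpace ℝ H] [IsScalarTower ℝ 𝕜 H]

/-- The coefficient of a solution along a vector of an eigenspace solves the scalar equation. -/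
lemma IsSolution.isScalarSolution (hA : StandingAssumption A κ) {α T l : ℝ} {u₀ : H} {u : ℝ → H}
    (hu : IsSolution A α T u₀ u) {e : H} (he : e ∈ (negEigenspace A l).topologicalClosure) :
    IsScalarSolution α T l (fun t => RCLike.re ⟪e, u t⟫_𝕜)
      (fun t => RCLike.re ⟪e, deriv u t⟫_𝕜) := by
  set Λ : H →L[ℝ] ℝ := (RCLike.reCLM (K := 𝕜)).comp ((innerSL 𝕜 e).restrictScalars ℝ) with hΛ
  have hΛa : ∀ x, Λ x = RCLike.re ⟪e, x⟫_𝕜 := fun x => rfl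
  simp only [← hΛa]
  have hcomp : ∀ {g : ℝ → H} {t : ℝ}, IntervalIntegrable g volume 0 t →
      IntervalIntegrable (fun s => Λ (g s)) volume 0 t := fun hg =>
    ⟨Λ.integrable_comp hg.1, Λ.integrable_comp hg.2⟩
  refine ⟨Λ.continuous.comp_continuousOn hu.continuousOn,
    fun t ht => hcomp (hu.deriv_integrable t ht), fun t ht => ?_, fun t ht => ?_, fun t ht => ?_⟩
  · rw [Λ.intervalIntegral_comp_comm (hu.deriv_integrable t ht), ← map_add,
      ← hu.eq_integral_deriv t ht]
  · simpa only [map_smul, smul_eq_mul] using hcomp (hu.caputo_integrable t ht)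
  · obtain ⟨hd, heq⟩ := hu.equation t ht
    have h1 := congrArg Λ heq
    rw [caputoDeriv, map_smul, ← Λ.intervalIntegral_comp_comm (hu.caputo_integrable t ht)] at h1
    simp only [map_smul, smul_eq_mul] at h1
    rw [h1, hΛa, hΛa, hA.inner_apply_of_mem he ⟨u t, hd⟩, neg_mul, map_neg, RCLike.re_ofReal_mul,
      neg_mul]

/-- Every spectral component of the initial value is controlled by that of the final value. -/
lemma IsSolution.norm_eigenProj_le (hA : StandingAssumption A κ) {α T : ℝ} (hα : 0 < α)
    (hα' : α < 1) (hT : 0 < T) {u₀ : H} {u : ℝ → H} (hu : IsSolution A α T u₀ u) (l : ℝ) :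
    ‖eigenProj A l (u 0)‖ ≤
      (1 + |Real.Gamma (1 - α) * T ^ α|) * max 1 (κ + l) * ‖eigenProj A l (u T)‖ := by
  set G := Real.Gamma (1 - α) * T ^ α with hG
  have hG0 : 0 ≤ G := by
    have hΓ : 0 < Real.Gamma (1 - α) := Real.Gamma_pos_of_pos (by linarith)
    positivity
  rw [abs_of_nonneg hG0]
  have hm1 : 1 ≤ max 1 (κ + l) := le_max_left _ _
  rcases eq_or_ne (eigenProj A l (u 0)) 0 with h0 | h0
  · rw [h0, norm_zero]
    positivity
  have hcomm : ∀ x, RCLike.re ⟪eigenProj A l (u 0), x⟫_𝕜 =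
      RCLike.re ⟪eigenProj A l (u 0), eigenProj A l x⟫_𝕜 := by
    intro x
    unfold eigenProj
    rw [← Submodule.inner_starProjection_left_eq_right,
      Submodule.starProjection_eq_self_iff.2 (Submodule.starProjection_apply_mem _ _)]
  -- With `e = P_l u(0)` as test vector, the scalar solution starts at `‖P_l u(0)‖ ^ 2 > 0`, and
  -- Cauchy–Schwarz bounds its final value.
  have hsol := hu.isScalarSolution hA (l := l) (e := eigenProj A l (u 0))
    (Submodule.starProjection_apply_mem _ _)
  have h00 : RCLike.re ⟪eigenProj A l (u 0), u 0⟫_𝕜 = ‖eigenProj A l (u 0)‖ ^ 2 := by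
    rw [hcomm, inner_self_eq_norm_sq]
  have hle := hsol.le_mul hα hα' hT (by rw [h00]; positivity)
  simp only [h00, ← hG] at hle
  have hTle : RCLike.re ⟪eigenProj A l (u 0), u T⟫_𝕜 ≤
      ‖eigenProj A l (u 0)‖ * ‖eigenProj A l (u T)‖ := by
    rw [hcomm]
    exact re_inner_le_norm _ _
  -- Here `κ ≥ 0` enters, through `l ≤ κ + l`; this keeps `κ` out of the constant.
  have hcoef : 1 + max l 0 * G ≤ (1 + G) * max 1 (κ + l) := by
    have hl : max l 0 ≤ max 1 (κ + l) :=
      max_le (le_trans (by linarith [hA.kappa_nonneg]) (le_max_right _ _)) (by linarith)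
    nlinarith [mul_le_mul_of_nonneg_right hl hG0]
  have hcoef0 : 0 ≤ 1 + max l 0 * G := by
    have := le_max_right l 0
    positivity
  have hpos : 0 < ‖eigenProj A l (u 0)‖ := norm_pos_iff.2 h0
  refine le_of_mul_le_mul_left ?_ hpos
  calc ‖eigenProj A l (u 0)‖ * ‖eigenProj A l (u 0)‖ = ‖eigenProj A l (u 0)‖ ^ 2 := by ring
    _ ≤ (1 + max l 0 * G) * (‖eigenProj A l (u 0)‖ * ‖eigenProj A l (u T)‖) :=
        hle.trans (mul_le_mul_of_nonneg_left hTle hcoef0)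
    _ ≤ ((1 + G) * max 1 (κ + l)) * (‖eigenProj A l (u 0)‖ * ‖eigenProj A l (u T)‖) :=
        mul_le_mul_of_nonneg_right hcoef (by positivity)
    _ = _ := by ring

end CaputoBackward

theorem theorem3 :
    ∃ C₂ : ℝ → ℝ → ℝ → ℝ, (∀ α T μ : ℝ, 0 < C₂ α T μ) ∧
      ∀ (𝕜 : Type*) [RCLike 𝕜] (H : Type*) [NormedAddCommGroup H] [InnerProductSpace 𝕜 H]
        [CompleteSpace H] [TopologicalSpace.SeparableSpace H]
        [NormedSpace ℝ H] [IsScalarTower ℝ 𝕜 H]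
        (A : H →ₗ.[𝕜] H) (κ : ℝ), CaputoBackward.StandingAssumption A κ →
      ∀ (α T ε R β : ℝ), 0 < α → α < 1 → 0 < T → 0 < ε → 0 < R → β = ε / (ε + 1) →
      ∀ (u₀ : H) (u : ℝ → H), u₀ ∈ CaputoBackward.admissibleSet A κ ε R →
        CaputoBackward.IsSolution A α T u₀ u →
        ‖u 0‖ ≤ (1 + C₂ α T (CaputoBackward.firstPosEigenvalue A) ^ β * R ^ (1 - β)) *
          ‖u T‖ ^ β := by
  -- The constant does not involve the first positive eigenvalue. The absolute value only secures
  -- positivity for all arguments; it is redundant for `0 < α < 1` and `T > 0`.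
  refine ⟨fun α T _ => 1 + |Real.Gamma (1 - α) * T ^ α|, fun α T _ => by positivity, ?_⟩
  intro 𝕜 _ H _ _ _ _ _ _ A κ hA α T ε R β hα hα' hT hε hR hβ u₀ u hu₀ hu
  have hu0 : u 0 ∈ CaputoBackward.admissibleSet A κ ε R := hu.initial ▸ hu₀
  set C := 1 + |Real.Gamma (1 - α) * T ^ α| with hC
  have hC0 : 0 < C := by positivity
  have h := CaputoBackward.le_rpow_mul_rpow_of_hasSum
    (a := fun l => ‖CaputoBackward.eigenProj A l (u 0)‖)
    (b := fun l => ‖CaputoBackward.eigenProj A l (u T)‖) (m := fun l => max 1 (κ + l))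
    (fun _ => norm_nonneg _)
    (fun _ => lt_of_lt_of_le one_pos (le_max_left _ _)) hC0.le (norm_nonneg (u T)) hR.le
    (norm_nonneg (u 0)) hε hβ (fun l => hu.norm_eigenProj_le hA hα hα' hT l)
    (hA.sum_max_rpow_le hu0 hR.le)
    (fun s => sum_le_hasSum s (fun l _ => sq_nonneg _) (hA.hasSum_norm_sq_eigenProj (u T)))
    (hA.hasSum_norm_sq_eigenProj (u 0))
  rw [Real.mul_rpow hC0.le (norm_nonneg _)] at h
  have hN : 0 ≤ ‖u T‖ ^ β := Real.rpow_nonneg (norm_nonneg _) _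
  -- The interpolation bound already holds without the summand `1`, whose contribution `‖u T‖ ^ β`
  -- is nonnegative.
  linarith
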